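/- Let $\xi(s)=(s-1)\,\Gamma\!\left(1+\tfrac s2\right)\pi^{-s/2}\zeta(s)$ be the Riemann $\xi$-function (an entire function, the removable singularities being filled in), and for $n\ge 0$ let $a_{2n}=\xi^{(2n)}(1/2)/(2n)!$ be its even Taylor coefficients at $s=\tfrac12$. Let $\rho$ run over the nontrivial zeros of the Riemann zeta function $\zeta$, i.e. all zeros other than $-2,-4,-6,\dots$, repeated according to multiplicity, and let $s_r=\sigma_r+it_r$ $(r=1,2,3,\dots)$ run over those with $t_r>0$, again with multiplicity, so that the nontrivial zeros are grouped in conjugate pairs $s_r,\bar s_r$. Let $\gamma$ be the Euler–Mascheroni constant. Then, for every $s\in\mathbb C$, $$\xi(s)=\sum_{n=0}^\infty a_{2n}\left(s-\tfrac12\right)^{2n},$$ and $$\sum_\rho\frac1\rho \;=\; 2\sum_{r}\frac{\sigma_r}{s_r\bar s_r}\;=\;8\sum_{n=1}^\infty\frac{n\,a_{2n}}{2^{2n}}\;=\;1+\frac{\gamma}{2}-\frac{\log(4\pi)}{2},$$ where the sums over $r$ and over $n$ converge absolutely, and $\sum_\rho 1/\rho$ is understood in either of the following two senses, which give the same value: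 as the limit $\lim_{T\to\infty}\sum_{|\operatorname{Im}\rho|\le T}1/\rho$, and as the absolutely convergent sum over conjugate pairs $\sum_r\left(\frac1{s_r}+\frac1{\bar s_r}\right)$. Moreover, the coefficient of $s$ in the expansion of $\xi$ in powers of $s$ is $$\xi'(0)=-\frac12\left(1+\frac{\gamma}{2}-\frac{\log(4\pi)}{2}\right).$$ -/

import Mathlib

namespace ZetaZeroSum

/-- The Riemann xi function `ξ(s) = (s - 1) Γ(1 + s/2) π^(-s/2) ζ(s)`, as an entire function: here
`completedRiemannZeta₀ s = π^(-s/2) Γ(s/2) ζ(s) + 1/s + 1/(1-s)`, so the removable singularities of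
the closed formula (at `s = 1` and `s = -2, -4, …`) are filled in. See `xi_eq`. -/
noncomputable def xi (s : ℂ) : ℂ :=
  1 / 2 + s * (s - 1) / 2 * completedRiemannZeta₀ s

theorem differentiable_xi : Differentiable ℂ xi := by
  have h := differentiable_completedZeta₀
  unfold xi
  fun_prop

/-- The closed formula for `xi` away from the points where that formula has to be read as a limit. -/
theorem xi_eq {s : ℂ} (h1 : s ≠ 1) (h2 : ∀ n : ℕ, s ≠ -2 * ((n : ℂ) + 1)) :
    xi s = (s - 1) * Complex.Gamma (1 + s / 2) * (Real.pi : ℂ) ^ (-s / 2) * riemannZeta s := by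
  by_cases h0 : s = 0
  · subst h0
    norm_num [xi, riemannZeta_zero]
  have hs1 : 1 - s ≠ 0 := sub_ne_zero.mpr (Ne.symm h1)
  have hG : Complex.Gammaℝ s ≠ 0 := by
    rw [Ne, Complex.Gammaℝ_eq_zero_iff]
    rintro ⟨n, hn⟩
    rcases n with _ | n
    · exact h0 (by simpa using hn)
    · exact h2 n (by rw [hn]; push_cast; ring)
  have hz := riemannZeta_def_of_ne_zero h0
  have hΛ : completedRiemannZeta s = Complex.Gammaℝ s * riemannZeta s := by
    rw [hz]; field_simp
  have h3 := completedRiemannZeta_eq s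
  have hadd : Complex.Gamma (1 + s / 2) = s / 2 * Complex.Gamma (s / 2) := by
    rw [add_comm, Complex.Gamma_add_one _ (by simpa using h0)]
  have h4 : completedRiemannZeta₀ s = Complex.Gammaℝ s * riemannZeta s + 1 / s + 1 / (1 - s) := by
    rw [← hΛ, h3]; ring
  rw [xi, h4, hadd, Complex.Gammaℝ_def]
  field_simp
  ring

/-- `evenTaylorCoeff n` is `a_{2n}`, the coefficient of `(s - 1/2)^(2n)` in the Taylor series of
`ξ` around `1/2`. -/
noncomputable def evenTaylorCoeff (n : ℕ) : ℂ :=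
  iteratedDeriv (2 * n) xi (1 / 2) / ((2 * n).factorial : ℂ)

/-- The nontrivial zeros of `ζ`: all of its zeros except `-2, -4, -6, …`. -/
def nontrivialZeros : Set ℂ :=
  {ρ : ℂ | riemannZeta ρ = 0 ∧ ∀ n : ℕ, ρ ≠ -2 * ((n : ℂ) + 1)}

/-- The nontrivial zeros in the upper half-plane, one from each pair `{ρ, conj ρ}`. -/
def upperZeros : Set ℂ :=
  {ρ : ℂ | ρ ∈ nontrivialZeros ∧ 0 < ρ.im}

/-- The multiplicity of a zero `ρ` of `ζ`. -/
noncomputable def zeroMult (ρ : ℂ) : ℕ := analyticOrderNatAt riemannZeta ρ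

theorem re_mem_of_mem_nontrivialZeros {ρ : ℂ} (h : ρ ∈ nontrivialZeros) :
    0 < ρ.re ∧ ρ.re < 1 := by
  obtain ⟨hz, ht⟩ := h
  constructor
  · by_contra hre
    push Not at hre
    have h0 : ρ ≠ 0 := by
      rintro rfl
      norm_num [riemannZeta_zero] at hz
    have hG : Complex.Gammaℝ ρ ≠ 0 := by
      rw [Ne, Complex.Gammaℝ_eq_zero_iff]
      rintro ⟨n, hn⟩
      rcases n with _ | n
      · exact h0 (by simpa using hn)
      · exact ht n (by rw [hn]; push_cast; ring)
    rw [riemannZeta_def_of_ne_zero h0, div_eq_zero_iff, or_iff_left hG,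
      ← completedRiemannZeta_one_sub] at hz
    have hre' : 1 ≤ (1 - ρ).re := by simp; exact hre
    have hne : 1 - ρ ≠ 0 := by
      intro hh
      rw [hh] at hre'
      norm_num at hre'
    refine riemannZeta_ne_zero_of_one_le_re hre' ?_
    rw [riemannZeta_def_of_ne_zero hne, hz, zero_div]
  · by_contra hre
    push Not at hre
    exact riemannZeta_ne_zero_of_one_le_re hre hz

theorem finite_zeros_of_abs_im_le (T : ℝ) :
    {ρ : ℂ | ρ ∈ nontrivialZeros ∧ |ρ.im| ≤ T}.Finite := by
  have hK : IsCompact (Set.Icc (0 : ℝ) 1 ×ℂ Set.Icc (-T) T) :=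
    isCompact_Icc.reProdIm isCompact_Icc
  refine hK.inter_riemannZetaZeros_finite.subset ?_
  rintro ρ ⟨hρ, hT⟩
  have h := re_mem_of_mem_nontrivialZeros hρ
  exact ⟨⟨⟨h.1.le, h.2.le⟩, abs_le.mp hT⟩, hρ.1⟩

/-- The finite set of nontrivial zeros with `|Im ρ| ≤ T`. -/
noncomputable def zerosUpTo (T : ℝ) : Finset ℂ := (finite_zeros_of_abs_im_le T).toFinset

end ZetaZeroSum

namespace ZetaZeroSum

open Complex Metric Set Filter Topology HurwitzZeta MeasureTheory


/-! The value of the sum is `-ξ'(0)/ξ(0)`: with `Λ₀ = completedRiemannZeta₀`, `ξ(0) = 1/2` and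
`ξ'(0) = -Λ₀(0)/2`, and `Λ₀(0)` is known explicitly. No Hadamard product is used.

Divide `ξ` by the polynomial of its zeros in the disc of radius `R` about `1/2`. The quotient `g`
has a logarithm there; Borel–Carathéodory and Cauchy show that `g'/g` changes by `O(M/R²)` between
`0` and `1`, where `exp M` bounds the growth of `ξ` (`norm_logDeriv_sub_le`). The symmetry `ξ(1 - s)
= ξ(s)` makes that change equal to twice `ξ'(0)/ξ(0) + ∑ 1/ρ` (`norm_logDeriv_add_sum_le`). As `M =
O(R log R)` by `exists_norm_xi_le`, the sums over discs converge (`tendsto_sum_zerosInBall`).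

Each `Re (1/ρ)` is nonnegative, so convergence over discs is absolute convergence of the real parts
and the order of summation is immaterial; imaginary parts cancel between conjugates. The Taylor
identity is the series of `ξ'` about `1/2`, evaluated at `1`. -/

/-! ### Zeros and logarithmic derivatives of entire functions -/

theorem analyticOrderAt_ne_top_of_differentiable {f : ℂ → ℂ} (hf : Differentiable ℂ f) {c : ℂ}
    (hc : f c ≠ 0) (z : ℂ) : analyticOrderAt f z ≠ ⊤ := by
  intro h
  rw [analyticOrderAt_eq_top] at h
  have ha : AnalyticOnNhd ℂ f univ := fun z _ => hf.analyticAt z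
  exact hc (ha.eqOn_zero_of_preconnected_of_eventuallyEq_zero isPreconnected_univ (mem_univ z) h
    (mem_univ c))

/-- Splitting off one zero of an entire function. -/
theorem exists_eq_pow_mul {f : ℂ → ℂ} (hf : Differentiable ℂ f) {a : ℂ}
    (ha : analyticOrderAt f a ≠ ⊤) :
    ∃ g : ℂ → ℂ, Differentiable ℂ g ∧ g a ≠ 0 ∧
      ∀ s, f s = (s - a) ^ analyticOrderNatAt f a * g s := by
  obtain ⟨g, hg, hga, hfg⟩ := (hf.analyticAt a).analyticOrderAt_ne_top.1 ha
  set m := analyticOrderNatAt f a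
  refine ⟨Function.update (fun s => f s / (s - a) ^ m) a (g a), ?_, by simpa using hga, ?_⟩
  · intro z
    rcases eq_or_ne z a with rfl | hz
    · refine hg.differentiableAt.congr_of_eventuallyEq ?_
      filter_upwards [hfg] with s hs
      rcases eq_or_ne s z with rfl | hsz
      · simp
      · rw [Function.update_of_ne hsz, hs, smul_eq_mul,
          mul_div_cancel_left₀ _ (pow_ne_zero _ (sub_ne_zero.2 hsz))]
    · have hd : DifferentiableAt ℂ (fun s => f s / (s - a) ^ m) z :=
        (hf z).div (by fun_prop) (pow_ne_zero _ (sub_ne_zero.2 hz))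
      refine hd.congr_of_eventuallyEq ?_
      filter_upwards [isOpen_ne.mem_nhds hz] with s hs
      rw [Function.update_of_ne hs]
  · intro s
    rcases eq_or_ne s a with rfl | hs
    · simpa using hfg.self_of_nhds
    · rw [Function.update_of_ne hs, mul_div_cancel₀ _ (pow_ne_zero _ (sub_ne_zero.2 hs))]

/-- Splitting off finitely many zeros of an entire function. -/
theorem exists_eq_prod_mul {f : ℂ → ℂ} (hf : Differentiable ℂ f) {c : ℂ} (hc : f c ≠ 0)
    (Z : Finset ℂ) :
    ∃ g : ℂ → ℂ, Differentiable ℂ g ∧ (∀ a ∈ Z, g a ≠ 0) ∧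
      ∀ s, f s = (∏ a ∈ Z, (s - a) ^ analyticOrderNatAt f a) * g s := by
  induction Z using Finset.induction_on with
  | empty => exact ⟨f, hf, by simp, by simp⟩
  | insert a Z haZ ih =>
    obtain ⟨g, hg, hgZ, hfg⟩ := ih
    have hgc : g c ≠ 0 := fun h => hc (by rw [hfg, h, mul_zero])
    have hga := analyticOrderAt_ne_top_of_differentiable hg hgc a
    obtain ⟨h, hh, hha, hgh⟩ := exists_eq_pow_mul hg hga
    have hP : Differentiable ℂ fun s => ∏ b ∈ Z, (s - b) ^ analyticOrderNatAt f b := by fun_prop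
    have hord : analyticOrderNatAt f a = analyticOrderNatAt g a := by
      have hf' : f = (fun s => ∏ b ∈ Z, (s - b) ^ analyticOrderNatAt f b) * g := funext hfg
      have h0 : analyticOrderAt (fun s => ∏ b ∈ Z, (s - b) ^ analyticOrderNatAt f b) a = 0 := by
        refine (hP.analyticAt a).analyticOrderAt_eq_zero.2 ?_
        refine Finset.prod_ne_zero_iff.2 fun b hb => pow_ne_zero _ (sub_ne_zero.2 ?_)
        rintro rfl
        exact haZ hb
      have := analyticOrderAt_mul (hP.analyticAt a) (hg.analyticAt a)
      rw [← hf', h0, zero_add] at this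
      rw [analyticOrderNatAt, this, analyticOrderNatAt]
    refine ⟨h, hh, ?_, fun s => ?_⟩
    · intro b hb
      rcases Finset.mem_insert.1 hb with rfl | hb
      · exact hha
      · intro h0
        exact hgZ b hb (by rw [hgh, h0, mul_zero])
    · rw [hfg, hgh, Finset.prod_insert haZ, hord]
      ring

/-- An analytic function without zeros in a disc has a logarithm there. -/
theorem exists_log_on_ball {g : ℂ → ℂ} (hg : Differentiable ℂ g) {c : ℂ} {R : ℝ} (hR : 0 < R)
    (h0 : ∀ z ∈ ball c R, g z ≠ 0) :
    ∃ L : ℂ → ℂ, L c = 0 ∧ (∀ z ∈ ball c R, HasDerivAt L (deriv g z / g z) z) ∧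
      ∀ z ∈ ball c R, g z = g c * exp (L z) := by
  have hd : DifferentiableOn ℂ (fun z => deriv g z / g z) (ball c R) := fun z hz =>
    ((hg.deriv z).div (hg z) (h0 z hz)).differentiableWithinAt
  obtain ⟨L, hL0, hL⟩ := hd.isExactOn_ball.with_val_at c 0
  refine ⟨L, hL0, hL, fun z hz => ?_⟩
  have hc : c ∈ ball c R := mem_ball_self hR
  have hder : ∀ w ∈ ball c R, HasDerivAt (fun w => g w * exp (-L w)) 0 w := by
    intro w hw
    have := (hg w).hasDerivAt.mul (hL w hw).neg.cexp
    refine this.congr_deriv ?_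
    have := h0 w hw
    field_simp
    ring
  have hconst := isOpen_ball.is_const_of_deriv_eq_zero (convex_ball c R).isPreconnected
    (fun w hw => (hder w hw).differentiableAt.differentiableWithinAt)
    (fun w hw => (hder w hw).deriv) hz hc
  simp only [hL0, neg_zero, Complex.exp_zero, mul_one] at hconst
  rw [← hconst, mul_assoc, ← Complex.exp_add]
  simp

/-- If `g` has no zeros in a disc and its modulus there is at most `exp M` times its value at the
centre, then its logarithmic derivative varies little near the centre. -/
theorem norm_logDeriv_sub_le {g : ℂ → ℂ} (hg : Differentiable ℂ g) {c : ℂ} {R M : ℝ} (hR : 4 ≤ R)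
    (hM : 0 < M) (h0 : ∀ z ∈ ball c R, g z ≠ 0)
    (hb : ∀ z ∈ ball c R, ‖g z‖ ≤ ‖g c‖ * Real.exp M) {z w : ℂ}
    (hz : z ∈ closedBall c (1 / 2)) (hw : w ∈ closedBall c (1 / 2)) :
    ‖deriv g z / g z - deriv g w / g w‖ ≤ 64 * M / R ^ 2 * ‖z - w‖ := by
  obtain ⟨L, hL0, hL, hgL⟩ := exists_log_on_ball hg (by linarith : 0 < R) h0
  have hLd : DifferentiableOn ℂ L (ball c R) := fun z hz =>
    (hL z hz).differentiableAt.differentiableWithinAt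
  have hc0 := h0 c (mem_ball_self (by linarith))
  have hre : ∀ z ∈ ball c R, (L z).re ≤ M := by
    intro z hz
    have h1 := hb z hz
    rw [hgL z hz, norm_mul, Complex.norm_exp] at h1
    exact Real.exp_le_exp.1 (le_of_mul_le_mul_left h1 (norm_pos_iff.2 hc0))
  have hbound : ∀ z ∈ closedBall c (R / 2), ‖L z‖ ≤ 2 * M := by
    intro z hz
    have hmaps : MapsTo (fun u => c + u) (ball 0 R) (ball c R) := by
      intro u hu
      simpa using hu
    have hzn : ‖z - c‖ ≤ R / 2 := by simpa [dist_eq_norm] using hz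
    -- The bound `2M r / (R - r)` is at most `2M` for `r ≤ R/2`.
    have := borelCaratheodory_zero (f := fun u => L (c + u)) (z := z - c) hM
      (hLd.comp (by fun_prop) hmaps) (fun u hu => hre _ (hmaps hu)) (by linarith)
      (by simp; linarith) (by simpa using hL0)
    simp only [add_sub_cancel] at this
    refine this.trans ?_
    rw [div_le_iff₀ (by linarith)]
    nlinarith
  have hderiv : ∀ z ∈ ball c R, deriv L z = deriv g z / g z := fun z hz => (hL z hz).deriv
  have hsub : closedBall c (1 / 2) ⊆ ball c R := closedBall_subset_ball (by linarith)
  rw [← hderiv z (hsub hz), ← hderiv w (hsub hw)]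
  have hLd' := hLd.deriv isOpen_ball
  refine (convex_closedBall c (1 / 2)).norm_image_sub_le_of_norm_deriv_le (𝕜 := ℂ)
    (fun u hu => (hLd' u (hsub hu)).differentiableAt (isOpen_ball.mem_nhds (hsub hu))) ?_ hw hz
  intro u hu
  have hsub' : closedBall u (R / 4) ⊆ closedBall c (R / 2) := by
    refine closedBall_subset_closedBall' ?_
    have := mem_closedBall.1 hu
    linarith
  have hsub2 : closedBall c (R / 2) ⊆ ball c R := closedBall_subset_ball (by linarith)
  -- Cauchy's estimate for `L''` gives `2! * 2M / (R/4)² = 64M / R²`.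
  have := norm_iteratedDeriv_le_of_forall_mem_sphere_norm_le (f := L) (c := u) (R := R / 4)
    (C := 2 * M) 2 (by linarith)
    ((hLd.mono (hsub'.trans hsub2)).diffContOnCl_ball subset_rfl)
    (fun v hv => hbound v (hsub' (sphere_subset_closedBall hv)))
  rw [iteratedDeriv_succ, iteratedDeriv_one] at this
  refine this.trans (le_of_eq ?_)
  have : R ≠ 0 := by linarith
  simp [Nat.factorial]
  field_simp
  norm_num

/-- A function symmetric about `1/2` with few zeros: the sum of the reciprocals of its zeros in a
disc around `1/2` nearly equals minus its logarithmic derivative at `0`. -/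
theorem norm_logDeriv_add_sum_le {f : ℂ → ℂ} (hf : Differentiable ℂ f)
    (hsymm : ∀ s, f (1 - s) = f s) (hc : f (1 / 2) ≠ 0) (h0 : f 0 ≠ 0) {R M : ℝ} (hR : 4 ≤ R)
    (hM : 0 < M) (hb : ∀ z ∈ closedBall (1 / 2 : ℂ) (3 * R), ‖f z‖ ≤ ‖f (1 / 2)‖ * Real.exp M)
    {Z : Finset ℂ} (hZ : ∀ a, a ∈ Z ↔ f a = 0 ∧ a ∈ ball (1 / 2 : ℂ) R) :
    ‖deriv f 0 / f 0 + ∑ a ∈ Z, (analyticOrderNatAt f a : ℂ) * (1 / a)‖ ≤ 32 * M / R ^ 2 := by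
  obtain ⟨g, hg, hgZ, hfg⟩ := exists_eq_prod_mul hf hc Z
  set P : ℂ → ℂ := fun s => ∏ a ∈ Z, (s - a) ^ analyticOrderNatAt f a with hP
  have hPd : Differentiable ℂ P := by fun_prop
  have hgne : ∀ z ∈ ball (1 / 2 : ℂ) R, g z ≠ 0 := by
    intro z hz hgz
    exact hgZ z ((hZ z).2 ⟨by rw [hfg, hgz, mul_zero], hz⟩) hgz
  have hP0 : ∀ z ∉ Z, P z ≠ 0 := fun z hz => Finset.prod_ne_zero_iff.2 fun a ha =>
    pow_ne_zero _ (sub_ne_zero.2 fun h => hz (h ▸ ha))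
  have hnot : ∀ z, f z ≠ 0 → z ∉ Z := fun z hz h => hz ((hZ z).1 h).1
  have hfg' : ∀ s, f s = P s * g s := hfg
  have hgb : ∀ z ∈ ball (1 / 2 : ℂ) R, ‖g z‖ ≤ ‖g (1 / 2)‖ * Real.exp M := by
    intro z hz
    -- Maximum principle on the larger disc: on its boundary every zero `a` in `Z` is at distance
    -- over `2R`, hence farther than from `1/2`, so dividing by `P` keeps the bound relative to the
    -- centre.
    refine Complex.norm_le_of_forall_mem_frontier_norm_le (U := ball (1 / 2 : ℂ) (3 * R))
      isBounded_ball hg.diffContOnCl ?_ (subset_closure (ball_subset_ball (by linarith) hz))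
    intro w hw
    rw [frontier_ball _ (by linarith)] at hw
    have hwn : ‖w - 1 / 2‖ = 3 * R := by simpa [dist_eq_norm] using hw
    have hPle : ‖P (1 / 2)‖ ≤ ‖P w‖ := by
      simp only [hP, norm_prod, norm_pow]
      refine Finset.prod_le_prod (fun _ _ => by positivity) fun a ha => ?_
      refine pow_le_pow_left₀ (norm_nonneg _) ?_ _
      have han := ((hZ a).1 ha).2
      rw [mem_ball, dist_eq_norm, norm_sub_rev] at han
      have h2 : ‖w - 1 / 2‖ ≤ ‖w - a‖ + ‖1 / 2 - a‖ := by
        have := norm_sub_le (w - a) (1 / 2 - a)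
        rwa [sub_sub_sub_cancel_right] at this
      linarith
    have hfw := hb w (sphere_subset_closedBall hw)
    rw [hfg' w, hfg' (1 / 2), norm_mul, norm_mul] at hfw
    have hPpos : 0 < ‖P (1 / 2)‖ := norm_pos_iff.2 (hP0 _ (hnot _ hc))
    refine le_of_mul_le_mul_left ?_ hPpos
    calc ‖P (1 / 2)‖ * ‖g w‖ ≤ ‖P w‖ * ‖g w‖ := by gcongr
      _ ≤ _ := by rw [← mul_assoc]; exact hfw
  have hlog : ∀ s, f s ≠ 0 → s ∈ ball (1 / 2 : ℂ) R →
      deriv f s / f s = ∑ a ∈ Z, (analyticOrderNatAt f a : ℂ) * (1 / (s - a)) +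
        deriv g s / g s := by
    intro s hs hsb
    have hsZ := hnot s hs
    have h1 := logDeriv_mul s (hP0 s hsZ) (hgne s hsb) (hPd s) (hg s)
    have h2 : (fun z => P z * g z) = f := funext fun z => (hfg' z).symm
    rw [h2] at h1
    rw [← logDeriv_apply, h1, ← logDeriv_apply, hP, logDeriv_prod]
    · congr 1
      refine Finset.sum_congr rfl fun a _ => ?_
      rw [logDeriv_fun_pow (by fun_prop)]
      congr 1
      simp [logDeriv_apply]
    · intro a ha
      exact pow_ne_zero _ (sub_ne_zero.2 fun h => hsZ (h ▸ ha))
    · intro a _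
      fun_prop
  have h1 : f 1 ≠ 0 := by
    have := hsymm 0
    rw [sub_zero] at this
    rwa [this]
  have hmem0 : (0 : ℂ) ∈ closedBall (1 / 2 : ℂ) (1 / 2) := by simp
  have hmem1 : (1 : ℂ) ∈ closedBall (1 / 2 : ℂ) (1 / 2) := by
    rw [mem_closedBall, dist_eq_norm]; norm_num
  have hsub : closedBall (1 / 2 : ℂ) (1 / 2) ⊆ ball (1 / 2 : ℂ) R :=
    closedBall_subset_ball (by linarith)
  have hmain := norm_logDeriv_sub_le hg hR hM hgne hgb hmem0 hmem1
  have e0 := hlog 0 h0 (hsub hmem0)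
  have e1 := hlog 1 h1 (hsub hmem1)
  have hderiv : deriv f 1 / f 1 = -(deriv f 0 / f 0) := by
    have hd : HasDerivAt (fun s => f (1 - s)) (-deriv f 1) 0 := by
      have := (hf (1 - 0)).hasDerivAt.comp_const_sub 1 0
      simpa using this
    have hd' : deriv f 0 = -deriv f 1 := by
      rw [← hd.deriv]
      congr 1
      exact funext fun s => (hsymm s).symm
    have hf1 : f 1 = f 0 := by simpa using hsymm 0
    rw [hf1, hd']
    ring
  have hord : ∀ a, analyticOrderNatAt f (1 - a) = analyticOrderNatAt f a := by
    intro a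
    have hcomp := analyticOrderAt_comp_of_deriv_ne_zero (f := f) (g := fun s : ℂ => 1 - s) (z₀ := a)
      (by fun_prop) (by simp)
    have : f ∘ (fun s => 1 - s) = f := funext hsymm
    rw [this] at hcomp
    rw [analyticOrderNatAt, analyticOrderNatAt, hcomp]
  have hrefl : ∑ a ∈ Z, (analyticOrderNatAt f a : ℂ) * (1 / (1 - a)) =
      ∑ a ∈ Z, (analyticOrderNatAt f a : ℂ) * (1 / a) := by
    have hm : ∀ a ∈ Z, 1 - a ∈ Z := by
      intro a ha
      obtain ⟨h, h'⟩ := (hZ a).1 ha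
      refine (hZ _).2 ⟨by rw [hsymm, h], ?_⟩
      rw [mem_ball, dist_eq_norm] at h' ⊢
      rwa [← norm_neg, show -(1 - a - 1 / 2) = a - 1 / 2 by ring]
    refine Finset.sum_nbij' (fun a => 1 - a) (fun a => 1 - a) hm hm (by simp) (by simp) ?_
    intro a _
    rw [hord]
  have hneg : ∑ a ∈ Z, (analyticOrderNatAt f a : ℂ) * (1 / (0 - a)) =
      -∑ a ∈ Z, (analyticOrderNatAt f a : ℂ) * (1 / a) := by
    rw [← Finset.sum_neg_distrib]
    refine Finset.sum_congr rfl fun a _ => ?_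
    rw [zero_sub, one_div_neg_eq_neg_one_div, mul_neg]
  rw [hneg] at e0
  rw [hderiv, hrefl] at e1
  -- Under `s ↦ 1 - s` both `f'/f` and the sum over `Z` at `1` are the negatives of those at `0`, so
  -- subtracting doubles them and leaves only `g`.
  have key : deriv f 0 / f 0 + ∑ a ∈ Z, (analyticOrderNatAt f a : ℂ) * (1 / a) =
      (deriv g 0 / g 0 - deriv g 1 / g 1) / 2 := by
    linear_combination (1 / 2) * e0 - (1 / 2) * e1
  rw [key, norm_div]
  have h2 : ‖(2 : ℂ)‖ = 2 := by norm_num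
  have h3 : ‖(0 : ℂ) - 1‖ = 1 := by norm_num
  rw [h3, mul_one] at hmain
  rw [h2]
  calc _ ≤ 64 * M / R ^ 2 / 2 := by gcongr
    _ = _ := by ring


/-! ### The completed zeta function as the Mellin transform of a nonnegative kernel -/

theorem one_le_evenKernel_zero {t : ℝ} (ht : 0 < t) : 1 ≤ evenKernel 0 t := by
  have h := hasSum_int_evenKernel 0 ht
  have := le_hasSum h 0 fun n _ => (Real.exp_pos _).le
  simpa using this

/-- The kernel of which `completedRiemannZeta₀` is a Mellin transform takes nonnegative values. -/
theorem f_modif_eq_norm {t : ℝ} (ht : 0 < t) :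
    (hurwitzEvenFEPair 0).f_modif t = (‖(hurwitzEvenFEPair 0).f_modif t‖ : ℂ) := by
  obtain ⟨r, hr, hr0⟩ : ∃ r : ℝ, (hurwitzEvenFEPair 0).f_modif t = r ∧ 0 ≤ r := by
    rcases lt_trichotomy t 1 with h1 | rfl | h1
    · refine ⟨evenKernel 0 t - t ^ (-(1 / 2) : ℝ), ?_, ?_⟩
      · simp [WeakFEPair.f_modif, h1, ht, h1.le, hurwitzEvenFEPair]
      -- The theta functional equation turns the difference into `t^(-1/2) (θ(1/t) - 1)`.
      · rw [evenKernel_functional_equation, ← evenKernel_eq_cosKernel_of_zero,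
          Real.rpow_neg ht.le, one_div, sub_nonneg]
        have := one_le_evenKernel_zero (one_div_pos.2 ht)
        exact le_mul_of_one_le_right (by positivity) this
    · exact ⟨0, by simp [WeakFEPair.f_modif], le_rfl⟩
    · refine ⟨evenKernel 0 t - 1, ?_, sub_nonneg.2 (one_le_evenKernel_zero ht)⟩
      simp [WeakFEPair.f_modif, h1, h1.le, hurwitzEvenFEPair]
  rw [hr, norm_real, Real.norm_of_nonneg hr0]

theorem completedRiemannZeta₀_eq_integral (s : ℂ) :
    completedRiemannZeta₀ s =
      (∫ t : ℝ in Ioi 0, (t : ℂ) ^ (s / 2 - 1) • (hurwitzEvenFEPair 0).f_modif t) / 2 :=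
  rfl

theorem integrableOn_f_modif (s : ℂ) :
    IntegrableOn (fun t : ℝ => (t : ℂ) ^ (s / 2 - 1) • (hurwitzEvenFEPair 0).f_modif t)
      (Ioi 0) :=
  ((hurwitzEvenFEPair 0).isStrongFEPair_toStrongFEPair.hasMellin (s / 2)).1

theorem norm_cpow_smul_f_modif {t : ℝ} (ht : t ∈ Ioi (0 : ℝ)) (s : ℂ) :
    ‖(t : ℂ) ^ (s / 2 - 1) • (hurwitzEvenFEPair 0).f_modif t‖ =
      t ^ (s.re / 2 - 1) * ‖(hurwitzEvenFEPair 0).f_modif t‖ := by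
  rw [norm_smul, norm_cpow_eq_rpow_re_of_pos ht]
  simp

theorem integrableOn_rpow_mul_norm_f_modif (x : ℝ) :
    IntegrableOn (fun t : ℝ => t ^ (x / 2 - 1) * ‖(hurwitzEvenFEPair 0).f_modif t‖) (Ioi 0) :=
  IntegrableOn.congr_fun (integrableOn_f_modif x).norm (fun t ht => by
    simpa using norm_cpow_smul_f_modif ht (x : ℂ)) measurableSet_Ioi

theorem completedRiemannZeta₀_ofReal (x : ℝ) :
    completedRiemannZeta₀ x =
      ((∫ t : ℝ in Ioi 0, t ^ (x / 2 - 1) * ‖(hurwitzEvenFEPair 0).f_modif t‖) / 2 : ℝ) := by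
  rw [completedRiemannZeta₀_eq_integral, ofReal_div, ← integral_complex_ofReal, ofReal_ofNat]
  congr 1
  refine setIntegral_congr_fun measurableSet_Ioi fun t ht => ?_
  rw [f_modif_eq_norm ht, ofReal_mul, ofReal_cpow (le_of_lt ht), smul_eq_mul]
  simp

theorem norm_completedRiemannZeta₀_ofReal (x : ℝ) :
    ‖completedRiemannZeta₀ x‖ =
      (∫ t : ℝ in Ioi 0, t ^ (x / 2 - 1) * ‖(hurwitzEvenFEPair 0).f_modif t‖) / 2 := by
  rw [completedRiemannZeta₀_ofReal, norm_real, Real.norm_of_nonneg]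
  exact div_nonneg (setIntegral_nonneg measurableSet_Ioi fun t ht =>
    mul_nonneg (Real.rpow_nonneg (le_of_lt ht) _) (norm_nonneg _)) zero_le_two

theorem norm_completedRiemannZeta₀_le (s : ℂ) :
    ‖completedRiemannZeta₀ s‖ ≤ ‖completedRiemannZeta₀ s.re‖ := by
  rw [norm_completedRiemannZeta₀_ofReal, completedRiemannZeta₀_eq_integral, norm_div]
  simp only [Complex.norm_ofNat]
  gcongr
  refine (norm_integral_le_integral_norm _).trans (le_of_eq ?_)
  exact setIntegral_congr_fun measurableSet_Ioi fun t ht => norm_cpow_smul_f_modif ht s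

/-- Under the integral, a power of `t` is at most its value at the right exponent for `t ≥ 1` and at
the left one for `t ≤ 1`. -/
theorem norm_completedRiemannZeta₀_ofReal_le_add {a x b : ℝ} (hax : a ≤ x) (hxb : x ≤ b) :
    ‖completedRiemannZeta₀ x‖ ≤ ‖completedRiemannZeta₀ a‖ + ‖completedRiemannZeta₀ b‖ := by
  simp only [norm_completedRiemannZeta₀_ofReal]
  rw [← add_div, ← integral_add (integrableOn_rpow_mul_norm_f_modif a)
    (integrableOn_rpow_mul_norm_f_modif b)]
  gcongr ?_ / 2
  refine setIntegral_mono_on (integrableOn_rpow_mul_norm_f_modif x)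
    ((integrableOn_rpow_mul_norm_f_modif a).add (integrableOn_rpow_mul_norm_f_modif b))
    measurableSet_Ioi fun t ht => ?_
  have ht0 : (0 : ℝ) < t := ht
  rw [← add_mul]
  gcongr
  rcases le_total 1 t with h1 | h1
  · exact (Real.rpow_le_rpow_of_exponent_le h1 (by linarith)).trans
      (le_add_of_nonneg_left (Real.rpow_nonneg ht0.le _))
  · exact (Real.rpow_le_rpow_of_exponent_ge ht0 h1 (by linarith)).trans
      (le_add_of_nonneg_right (Real.rpow_nonneg ht0.le _))

theorem completedRiemannZeta₀_zero_eq :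
    completedRiemannZeta₀ 0 =
      ((1 + Real.eulerMascheroniConstant / 2 - Real.log (4 * Real.pi) / 2 : ℝ) : ℂ) := by
  rw [completedRiemannZeta₀_zero]
  push_cast [ofReal_log (by positivity : (0 : ℝ) ≤ 4 * Real.pi)]
  ring

/-- The value is nonnegative, being the integral of a nonnegative kernel, so an upper bound
suffices: `γ < 2/3` and `log (4π) > 1`. -/
theorem norm_completedRiemannZeta₀_zero_lt : ‖completedRiemannZeta₀ 0‖ < 1 := by
  have h := completedRiemannZeta₀_ofReal 0
  have hn := norm_completedRiemannZeta₀_ofReal 0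
  rw [← hn, ofReal_zero, completedRiemannZeta₀_zero_eq, ofReal_inj] at h
  rw [completedRiemannZeta₀_zero_eq, ← h]
  have h1 := Real.eulerMascheroniConstant_lt_two_thirds
  have h2 : 1 < Real.log (4 * Real.pi) := by
    rw [Real.lt_log_iff_exp_lt (by positivity)]
    linarith [Real.exp_one_lt_d9, Real.pi_gt_three]
  linarith

/-! ### Symmetry, zeros and multiplicities of `xi` -/

theorem xi_one_sub (s : ℂ) : xi (1 - s) = xi s := by
  rw [xi, xi, completedRiemannZeta₀_one_sub]
  ring

theorem xi_zero : xi 0 = 1 / 2 := by simp [xi]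

theorem xi_one : xi 1 = 1 / 2 := by simp [xi]

/-- On `[0, 1]`, `|Λ₀(x)| ≤ 2|Λ₀(0)| < 2` and `x(1 - x)/2 ≤ 1/8`, so the second term of `xi` cannot
cancel `1/2`. This excludes real nontrivial zeros and the centre `1/2`. -/
theorem xi_ofReal_ne_zero {x : ℝ} (h0 : 0 ≤ x) (h1 : x ≤ 1) : xi x ≠ 0 := by
  intro h
  have hb := norm_completedRiemannZeta₀_ofReal_le_add h0 h1
  have h01 : completedRiemannZeta₀ ((1 : ℝ) : ℂ) = completedRiemannZeta₀ 0 := by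
    rw [← completedRiemannZeta₀_one_sub]
    simp
  rw [h01, ofReal_zero] at hb
  have hlt := norm_completedRiemannZeta₀_zero_lt
  have heq : (1 / 2 : ℂ) = ((x * (1 - x) / 2 : ℝ) : ℂ) * completedRiemannZeta₀ x := by
    rw [xi] at h
    push_cast
    linear_combination h
  have hn := congrArg norm heq
  rw [norm_mul, norm_real, Real.norm_of_nonneg (by nlinarith)] at hn
  have h2 : ‖(1 / 2 : ℂ)‖ = 1 / 2 := by norm_num
  rw [h2] at hn
  have h3 : x * (1 - x) / 2 ≤ 1 / 8 := by nlinarith [sq_nonneg (x - 1 / 2)]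
  nlinarith [norm_nonneg (completedRiemannZeta₀ x), mul_nonneg h0 (sub_nonneg.2 h1)]

theorem xi_eq_zero_iff_of_ne {s : ℂ} (h1 : s ≠ 1) (h2 : ∀ n : ℕ, s ≠ -2 * ((n : ℂ) + 1)) :
    xi s = 0 ↔ riemannZeta s = 0 := by
  have hG : Gamma (1 + s / 2) ≠ 0 := Gamma_ne_zero fun m hm =>
    h2 m (by linear_combination 2 * hm)
  have hpi : (Real.pi : ℂ) ^ (-s / 2) ≠ 0 := by
    rw [cpow_def_of_ne_zero (ofReal_ne_zero.2 Real.pi_ne_zero)]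
    exact exp_ne_zero _
  rw [xi_eq h1 h2]
  simp [sub_ne_zero.2 h1, hG, hpi]

theorem xi_eq_zero_iff {s : ℂ} : xi s = 0 ↔ s ∈ nontrivialZeros := by
  constructor
  · intro h
    have h1 : s ≠ 1 := by
      rintro rfl
      norm_num [xi_one] at h
    have h2 : ∀ n : ℕ, s ≠ -2 * ((n : ℂ) + 1) := by
      rintro n rfl
      -- The closed formula fails at a trivial zero; reflection moves the point to `3 + 2n`, where
      -- `ζ` does not vanish.
      rw [← xi_one_sub] at h
      have hre : (1 - -2 * ((n : ℂ) + 1)).re = 3 + 2 * n := by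
        simp
        ring
      have hn : (0 : ℝ) ≤ n := n.cast_nonneg
      refine riemannZeta_ne_zero_of_one_le_re (s := 1 - -2 * ((n : ℂ) + 1)) (by linarith)
        ((xi_eq_zero_iff_of_ne ?_ ?_).1 h)
      · intro h'
        rw [h', one_re] at hre
        linarith
      · intro m h'
        rw [h'] at hre
        simp at hre
        have hm : (0 : ℝ) ≤ m := m.cast_nonneg
        linarith
    exact ⟨(xi_eq_zero_iff_of_ne h1 h2).1 h, h2⟩
  · intro h
    refine (xi_eq_zero_iff_of_ne ?_ h.2).2 h.1
    rintro rfl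
    exact riemannZeta_one_ne_zero h.1

theorem ne_one_of_mem_nontrivialZeros {ρ : ℂ} (h : ρ ∈ nontrivialZeros) : ρ ≠ 1 := by
  rintro rfl
  exact riemannZeta_one_ne_zero h.1

theorem ne_zero_of_mem_nontrivialZeros {ρ : ℂ} (h : ρ ∈ nontrivialZeros) : ρ ≠ 0 := by
  rintro rfl
  exact absurd h.1 (by norm_num [riemannZeta_zero])

theorem im_ne_zero_of_mem_nontrivialZeros {ρ : ℂ} (h : ρ ∈ nontrivialZeros) : ρ.im ≠ 0 := by
  intro him
  have hre := re_mem_of_mem_nontrivialZeros h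
  refine xi_ofReal_ne_zero hre.1.le hre.2.le ?_
  rw [show ((ρ.re : ℝ) : ℂ) = ρ from Complex.ext rfl (by simp [him])]
  exact xi_eq_zero_iff.2 h

theorem analyticOrderNatAt_xi {ρ : ℂ} (h : ρ ∈ nontrivialZeros) :
    analyticOrderNatAt xi ρ = zeroMult ρ := by
  have hre := re_mem_of_mem_nontrivialZeros h
  set U : ℂ → ℂ := fun s => (s - 1) * Gamma (1 + s / 2) * (Real.pi : ℂ) ^ (-s / 2) with hU
  have hopen : IsOpen {s : ℂ | 0 < s.re} := isOpen_lt continuous_const continuous_re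
  have hUd : AnalyticAt ℂ U ρ := by
    refine DifferentiableOn.analyticAt (s := {s : ℂ | 0 < s.re}) (fun s hs => ?_)
      (hopen.mem_nhds hre.1)
    have hs' : 0 < s.re := hs
    have hG : DifferentiableAt ℂ Gamma (1 + s / 2) := by
      refine differentiableAt_Gamma _ fun m hm => ?_
      have := congrArg re hm
      simp at this
      have hm0 : (0 : ℝ) ≤ m := m.cast_nonneg
      linarith
    have hG' : DifferentiableAt ℂ (fun s => Gamma (1 + s / 2)) s :=
      DifferentiableAt.comp s hG (by fun_prop)
    have hpi : DifferentiableAt ℂ (fun s : ℂ => (Real.pi : ℂ) ^ (-s / 2)) s :=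
      DifferentiableAt.const_cpow (by fun_prop) (Or.inl (ofReal_ne_zero.2 Real.pi_ne_zero))
    exact (((by fun_prop : DifferentiableAt ℂ (fun s : ℂ => s - 1) s).mul hG').mul
      hpi).differentiableWithinAt
  have hU0 : U ρ ≠ 0 := by
    have hG : Gamma (1 + ρ / 2) ≠ 0 := Gamma_ne_zero fun m hm =>
      h.2 m (by linear_combination 2 * hm)
    have hpi : (Real.pi : ℂ) ^ (-ρ / 2) ≠ 0 := by
      rw [cpow_def_of_ne_zero (ofReal_ne_zero.2 Real.pi_ne_zero)]
      exact exp_ne_zero _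
    exact mul_ne_zero (mul_ne_zero (sub_ne_zero.2 (ne_one_of_mem_nontrivialZeros h)) hG) hpi
  have heq : xi =ᶠ[𝓝 ρ] U * riemannZeta := by
    filter_upwards [hopen.mem_nhds hre.1, isOpen_ne.mem_nhds (ne_one_of_mem_nontrivialZeros h)]
      with s hs hs1
    refine xi_eq hs1 fun n hn => ?_
    have hs' : 0 < s.re := hs
    rw [hn] at hs'
    simp at hs'
    have hn0 : (0 : ℝ) ≤ n := n.cast_nonneg
    linarith
  have hζ : AnalyticAt ℂ riemannZeta ρ :=
    analyticOn_riemannZeta ρ (ne_one_of_mem_nontrivialZeros h)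
  have := analyticOrderAt_mul hUd hζ
  rw [hUd.analyticOrderAt_eq_zero.2 hU0, zero_add] at this
  rw [analyticOrderNatAt, analyticOrderAt_congr heq, this, zeroMult, analyticOrderNatAt]

theorem conj_mem_nontrivialZeros {ρ : ℂ} (h : ρ ∈ nontrivialZeros) :
    (starRingEnd ℂ) ρ ∈ nontrivialZeros := by
  refine ⟨by rw [riemannZeta_conj, h.1, map_zero], fun n hn => h.2 n ?_⟩
  have := congrArg (starRingEnd ℂ) hn
  rw [conj_conj] at this
  rw [this]
  simp only [map_mul, map_neg, map_add, map_one, map_natCast, map_ofNat]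

/-- Complex conjugation does not change the order of a function that commutes with it. -/
theorem analyticOrderNatAt_conj {f : ℂ → ℂ}
    (hf : ∀ s, f ((starRingEnd ℂ) s) = (starRingEnd ℂ) (f s)) {z : ℂ} (hz : AnalyticAt ℂ f z)
    (hz' : AnalyticAt ℂ f ((starRingEnd ℂ) z)) (ht : analyticOrderAt f z ≠ ⊤) :
    analyticOrderNatAt f ((starRingEnd ℂ) z) = analyticOrderNatAt f z := by
  obtain ⟨g, hg, hg0, hfg⟩ := hz.analyticOrderAt_ne_top.1 ht
  have hcont : Tendsto (starRingEnd ℂ) (𝓝 ((starRingEnd ℂ) z)) (𝓝 z) := by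
    have := (continuous_conj.tendsto ((starRingEnd ℂ) z))
    rwa [conj_conj] at this
  have hev : ∀ᶠ s in 𝓝 ((starRingEnd ℂ) z), f s = (s - (starRingEnd ℂ) z) ^
      analyticOrderNatAt f z • (starRingEnd ℂ) (g ((starRingEnd ℂ) s)) := by
    filter_upwards [hcont.eventually hfg] with s hs
    have := hf ((starRingEnd ℂ) s)
    rw [conj_conj, hs] at this
    rw [this]
    simp
  have hga : AnalyticAt ℂ (fun s => (starRingEnd ℂ) (g ((starRingEnd ℂ) s)))
      ((starRingEnd ℂ) z) := by
    rw [analyticAt_iff_eventually_differentiableAt] at hg ⊢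
    filter_upwards [hcont.eventually hg] with s hs
    exact differentiableAt_conj_conj_iff.2 hs
  have hord := (hz'.analyticOrderAt_eq_natCast (n := analyticOrderNatAt f z)).2
    ⟨_, hga, by simpa using hg0, hev⟩
  rw [analyticOrderNatAt, hord, ENat.toNat_natCast]

theorem zeroMult_conj {ρ : ℂ} (h : ρ ∈ nontrivialZeros) :
    zeroMult ((starRingEnd ℂ) ρ) = zeroMult ρ := by
  have hρ := analyticOn_riemannZeta ρ (ne_one_of_mem_nontrivialZeros h)
  refine analyticOrderNatAt_conj riemannZeta_conj hρ
    (analyticOn_riemannZeta _ (ne_one_of_mem_nontrivialZeros (conj_mem_nontrivialZeros h))) ?_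
  intro ht
  -- Infinite order would force `ζ = 0` on the connected set `ℂ \ {1}`, against `ζ(0) = -1/2`.
  have h0 := analyticOn_riemannZeta.eqOn_zero_of_preconnected_of_eventuallyEq_zero
    (isConnected_compl_singleton_of_one_lt_rank (by simp) 1).isPreconnected
    (ne_one_of_mem_nontrivialZeros h) (analyticOrderAt_eq_top.1 ht) (by simp : (0 : ℂ) ∈ _)
  norm_num [riemannZeta_zero] at h0

theorem hasDerivAt_xi_zero : HasDerivAt xi (-(1 / 2) * completedRiemannZeta₀ 0) 0 := by
  have h1 : HasDerivAt (fun s : ℂ => s * (s - 1) / 2) (-(1 / 2)) 0 := by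
    have := (((hasDerivAt_id (0 : ℂ)).mul ((hasDerivAt_id (0 : ℂ)).sub_const 1)).div_const 2)
    refine this.congr_deriv ?_
    simp
    norm_num
  have h2 := (h1.mul (differentiable_completedZeta₀ 0).hasDerivAt).const_add (1 / 2 : ℂ)
  refine h2.congr_deriv ?_
  simp

/-! ### Growth of `xi` -/

theorem norm_riemannZeta_ofReal_le {x : ℝ} (hx : 2 ≤ x) : ‖riemannZeta x‖ ≤ 2 := by
  rw [zeta_eq_tsum_one_div_nat_cpow (by simp; linarith)]
  refine (tsum_of_norm_bounded hasSum_zeta_two fun n => ?_).trans ?_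
  · rcases n.eq_zero_or_pos with rfl | hn
    · have : (x : ℂ) ≠ 0 := ofReal_ne_zero.2 (by linarith)
      simp [this]
    · rw [norm_div, norm_one, norm_natCast_cpow_of_pos hn, ofReal_re]
      have h1 : (1 : ℝ) ≤ n := by exact_mod_cast hn
      gcongr
      rw [← Real.rpow_natCast]
      exact Real.rpow_le_rpow_of_exponent_le h1 (by simpa using hx)
  · nlinarith [Real.pi_lt_d2, Real.pi_pos]

theorem Gamma_le_exp {x R : ℝ} (hx : 2 ≤ x) (hR : x + 1 ≤ R) :
    Real.Gamma x ≤ Real.exp (R * Real.log R) := by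
  set n := ⌈x⌉₊
  have hn1 : x ≤ n := Nat.le_ceil x
  have hn2 : (n : ℝ) ≤ R := (Nat.ceil_lt_add_one (by linarith)).le.trans hR
  have hmono : Real.Gamma x ≤ Real.Gamma (n + 1) :=
    Real.Gamma_strictMonoOn_Ici.monotoneOn (mem_Ici.2 hx) (mem_Ici.2 (by linarith))
      (by linarith)
  have hR0 : 1 ≤ R := by linarith
  calc Real.Gamma x ≤ (n.factorial : ℝ) := by rwa [← Real.Gamma_nat_eq_factorial]
    _ ≤ (n : ℝ) ^ n := by exact_mod_cast n.factorial_le_pow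
    _ ≤ R ^ n := by gcongr
    _ = R ^ (n : ℝ) := (Real.rpow_natCast _ _).symm
    _ ≤ R ^ R := Real.rpow_le_rpow_of_exponent_le hR0 hn2
    _ = _ := by rw [Real.rpow_def_of_pos (by linarith), mul_comm]

theorem norm_completedRiemannZeta₀_ofReal_le {x R : ℝ} (hx : 4 ≤ x) (hR : x / 2 + 1 ≤ R) :
    ‖completedRiemannZeta₀ x‖ ≤ 2 * Real.exp (R * Real.log R) + 2 := by
  have hx0 : (x : ℂ) ≠ 0 := ofReal_ne_zero.2 (by linarith)
  have hG : Gammaℝ x ≠ 0 := Gammaℝ_ne_zero_of_re_pos (by simp; linarith)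
  have hΛ : completedRiemannZeta x = Gammaℝ x * riemannZeta x := by
    rw [riemannZeta_def_of_ne_zero hx0]
    field_simp
  have h := completedRiemannZeta_eq (x : ℂ)
  have h' : completedRiemannZeta₀ x =
      Gammaℝ x * riemannZeta x + ((1 / x + 1 / (1 - x) : ℝ) : ℂ) := by
    rw [← hΛ, h]
    push_cast
    ring
  have hb : ‖Gammaℝ x‖ ≤ Real.exp (R * Real.log R) := by
    have e : (x : ℂ) / 2 = ((x / 2 : ℝ) : ℂ) := by push_cast; ring
    rw [Gammaℝ, norm_mul, e, Gamma_ofReal, norm_real,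
      Real.norm_of_nonneg (Real.Gamma_pos_of_pos (by linarith)).le,
      norm_cpow_eq_rpow_re_of_pos Real.pi_pos]
    have h1 : Real.pi ^ ((-(x : ℂ) / 2).re) ≤ 1 := by
      refine Real.rpow_le_one_of_one_le_of_nonpos (by linarith [Real.pi_gt_three]) ?_
      simp
      linarith
    calc _ ≤ 1 * Real.Gamma (x / 2) :=
          mul_le_mul_of_nonneg_right h1 (Real.Gamma_pos_of_pos (by linarith)).le
      _ ≤ _ := by rw [one_mul]; exact Gamma_le_exp (by linarith) hR
  rw [h']
  refine (norm_add_le _ _).trans (add_le_add ?_ ?_)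
  · rw [norm_mul, mul_comm 2]
    exact mul_le_mul hb (norm_riemannZeta_ofReal_le (by linarith)) (norm_nonneg _)
      (Real.exp_pos _).le
  · rw [norm_real, Real.norm_eq_abs]
    refine (abs_add_le _ _).trans ?_
    have h1 : |1 / x| ≤ 1 := by
      rw [abs_of_nonneg (by positivity), div_le_one (by linarith)]; linarith
    have h2 : |1 / (1 - x)| ≤ 1 := by
      rw [abs_div, abs_one, div_le_one (by rw [abs_pos]; linarith), abs_of_nonpos (by linarith)]
      linarith
    linarith

/-- The function `xi` has order at most one. -/
theorem exists_norm_xi_le : ∃ D > 0, ∀ R ≥ 4, ∀ s : ℂ, ‖s - 1 / 2‖ ≤ R →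
    ‖xi s‖ ≤ D * Real.exp ((R + 2) * Real.log R) := by
  set C := ‖completedRiemannZeta₀ ((1 / 2 : ℝ) : ℂ)‖ + ‖completedRiemannZeta₀ ((4 : ℝ) : ℂ)‖
    with hC
  have hC0 : 0 ≤ C := by positivity
  -- `C` covers `1/2 ≤ Re s ≤ 4`, and `2E + 2 ≤ 4E` covers `Re s ≥ 4`; the extra unit absorbs the
  -- term `1/2` of `xi`. The functional equation handles `Re s ≤ 1/2`.
  refine ⟨2 * (C + 5), by positivity, fun R hR => ?_⟩
  have key : ∀ s : ℂ, 1 / 2 ≤ s.re → ‖s - 1 / 2‖ ≤ R →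
      ‖xi s‖ ≤ 2 * (C + 5) * Real.exp ((R + 2) * Real.log R) := by
    intro s hs hsR
    have hlog : 0 ≤ R * Real.log R := mul_nonneg (by linarith) (Real.log_nonneg (by linarith))
    set E := Real.exp (R * Real.log R) with hE
    have hE1 : 1 ≤ E := Real.one_le_exp hlog
    have hΛ : ‖completedRiemannZeta₀ s‖ ≤ (C + 4) * E := by
      refine (norm_completedRiemannZeta₀_le s).trans ?_
      rcases le_total s.re 4 with h4 | h4
      · refine (norm_completedRiemannZeta₀_ofReal_le_add hs h4).trans ?_
        rw [← hC]
        nlinarith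
      · have hre : s.re - 1 / 2 ≤ R := by
          refine le_trans (le_trans (le_of_eq ?_) (re_le_norm (s - 1 / 2))) hsR
          simp
        refine (norm_completedRiemannZeta₀_ofReal_le (R := R) h4 (by linarith)).trans ?_
        rw [← hE]
        nlinarith
    have hh : ‖(1 / 2 : ℂ)‖ = 1 / 2 := by norm_num
    have hs1 : ‖s‖ ≤ 2 * R := by
      have := norm_add_le (s - 1 / 2) (1 / 2)
      rw [sub_add_cancel, hh] at this
      linarith
    have hs2 : ‖s - 1‖ ≤ 2 * R := by
      have := norm_sub_le (s - 1 / 2) (1 / 2)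
      rw [hh, show s - 1 / 2 - 1 / 2 = s - 1 by ring] at this
      linarith
    have hexp : Real.exp ((R + 2) * Real.log R) = E * R ^ 2 := by
      rw [add_mul, Real.exp_add, ← hE, two_mul (Real.log R), Real.exp_add,
        Real.exp_log (by linarith), sq]
    have hER : 1 ≤ E * R ^ 2 := by nlinarith
    rw [hexp, xi]
    refine (norm_add_le _ _).trans ?_
    rw [hh, norm_mul, norm_div, norm_mul, Complex.norm_ofNat]
    calc 1 / 2 + ‖s‖ * ‖s - 1‖ / 2 * ‖completedRiemannZeta₀ s‖
        ≤ 1 / 2 + 2 * R * (2 * R) / 2 * ((C + 4) * E) := by gcongr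
      _ = 1 / 2 + 2 * (C + 4) * (E * R ^ 2) := by ring
      _ ≤ 2 * (C + 5) * (E * R ^ 2) := by nlinarith
  intro s hs
  rcases le_total (1 / 2) s.re with h | h
  · exact key s h hs
  · rw [← xi_one_sub]
    refine key _ (by simp; linarith) ?_
    rwa [← norm_neg, show -(1 - s - 1 / 2) = s - 1 / 2 by ring]


/-! ### Summation over the zeros -/

theorem finite_zeros_of_mem_ball (R : ℝ) :
    {ρ : ℂ | ρ ∈ nontrivialZeros ∧ ρ ∈ ball (1 / 2 : ℂ) R}.Finite := by
  refine (finite_zeros_of_abs_im_le R).subset fun ρ hρ => ⟨hρ.1, ?_⟩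
  have h := hρ.2
  rw [mem_ball, dist_eq_norm] at h
  have := (abs_im_le_norm (ρ - 1 / 2)).trans h.le
  simpa using this

/-- The finite set of nontrivial zeros in the disc of radius `R` around `1/2`. -/
noncomputable def zerosInBall (R : ℝ) : Finset ℂ := (finite_zeros_of_mem_ball R).toFinset

theorem mem_zerosInBall {R : ℝ} {ρ : ℂ} :
    ρ ∈ zerosInBall R ↔ ρ ∈ nontrivialZeros ∧ ρ ∈ ball (1 / 2 : ℂ) R := by
  simp [zerosInBall]

theorem mem_zerosUpTo {T : ℝ} {ρ : ℂ} :
    ρ ∈ zerosUpTo T ↔ ρ ∈ nontrivialZeros ∧ |ρ.im| ≤ T := by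
  simp [zerosUpTo]

theorem xi_half_ne_zero : xi (1 / 2) ≠ 0 := by
  have := xi_ofReal_ne_zero (x := 1 / 2) (by norm_num) (by norm_num)
  simpa using this

theorem tendsto_growth_div_sq (c : ℝ) :
    Tendsto (fun R : ℝ => 32 * (c + (3 * R + 2) * Real.log (3 * R)) / R ^ 2) atTop (𝓝 0) := by
  have hinv : Tendsto (fun R : ℝ => R⁻¹) atTop (𝓝 0) := tendsto_inv_atTop_zero
  have hlog : Tendsto (fun R : ℝ => Real.log R / R) atTop (𝓝 0) :=
    Real.isLittleO_log_id_atTop.tendsto_div_nhds_zero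
  have h := (((hinv.mul hinv).const_mul c).add (((hinv.const_mul 2).const_add 3).mul
    ((hinv.const_mul (Real.log 3)).add hlog))).const_mul 32
  simp only [mul_zero, add_zero] at h
  refine h.congr' ?_
  filter_upwards [eventually_gt_atTop 0] with R hR
  rw [Real.log_mul (by norm_num) hR.ne']
  field_simp

theorem tendsto_sum_zerosInBall :
    Tendsto (fun R : ℝ => ∑ ρ ∈ zerosInBall R, (zeroMult ρ : ℂ) * (1 / ρ)) atTop
      (𝓝 (completedRiemannZeta₀ 0)) := by
  obtain ⟨D, hD, hgrowth⟩ := exists_norm_xi_le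
  have hc : 0 < ‖xi (1 / 2)‖ := norm_pos_iff.2 xi_half_ne_zero
  -- This moves the constant of the growth bound into the exponent; the absolute value keeps `M`
  -- positive.
  set c := |Real.log (D / ‖xi (1 / 2)‖)|
  have hlim := tendsto_growth_div_sq c
  rw [tendsto_iff_norm_sub_tendsto_zero]
  refine squeeze_zero' (Eventually.of_forall fun _ => norm_nonneg _) ?_ hlim
  filter_upwards [eventually_ge_atTop 4] with R hR
  have hlog : 0 < Real.log (3 * R) := Real.log_pos (by linarith)
  have hM : 0 < c + (3 * R + 2) * Real.log (3 * R) :=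
    add_pos_of_nonneg_of_pos (abs_nonneg _) (mul_pos (by linarith) hlog)
  have hx0 : xi 0 ≠ 0 := by rw [xi_zero]; norm_num
  have h := norm_logDeriv_add_sum_le differentiable_xi xi_one_sub xi_half_ne_zero hx0 hR hM
    (fun z hz => ?_) (Z := zerosInBall R) (fun a => by rw [mem_zerosInBall, xi_eq_zero_iff])
  · rw [hasDerivAt_xi_zero.deriv, xi_zero] at h
    refine le_trans (le_of_eq ?_) h
    congr 1
    rw [sub_eq_neg_add]
    congr 1
    · ring
    · refine Finset.sum_congr rfl fun a ha => ?_
      rw [analyticOrderNatAt_xi (mem_zerosInBall.1 ha).1]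
  · rw [mem_closedBall, dist_eq_norm] at hz
    refine (hgrowth (3 * R) (by linarith) z hz).trans ?_
    rw [Real.exp_add, ← mul_assoc]
    gcongr
    rw [← div_le_iff₀' hc]
    exact (Real.exp_log (by positivity)).symm.le.trans (Real.exp_le_exp.2 (le_abs_self _))

/-- The real part of `1/ρ`, counted with the multiplicity of the zero `ρ`. -/
noncomputable def zeroWeight (ρ : ℂ) : ℝ := zeroMult ρ * (ρ.re / normSq ρ)

theorem re_zeroMult_mul_inv (ρ : ℂ) : ((zeroMult ρ : ℂ) * (1 / ρ)).re = zeroWeight ρ := by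
  rw [← ofReal_natCast, re_ofReal_mul, one_div, inv_re, zeroWeight]

theorem zeroWeight_nonneg {ρ : ℂ} (h : ρ ∈ nontrivialZeros) : 0 ≤ zeroWeight ρ :=
  mul_nonneg (Nat.cast_nonneg _)
    (div_nonneg (re_mem_of_mem_nontrivialZeros h).1.le (normSq_nonneg _))

theorem zeroWeight_conj {ρ : ℂ} (h : ρ ∈ nontrivialZeros) :
    zeroWeight ((starRingEnd ℂ) ρ) = zeroWeight ρ := by
  rw [zeroWeight, zeroMult_conj h, conj_re, normSq_conj, zeroWeight]

/-- The terms are nonnegative and every finite set of zeros lies in some disc, so the limit over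
discs is the supremum of all finite partial sums. -/
theorem hasSum_indicator_zeroWeight :
    HasSum (nontrivialZeros.indicator zeroWeight) (completedRiemannZeta₀ 0).re := by
  have hnn : ∀ ρ, 0 ≤ nontrivialZeros.indicator zeroWeight ρ :=
    indicator_nonneg fun ρ h => zeroWeight_nonneg h
  have hsum : ∀ R, ∑ ρ ∈ zerosInBall R, nontrivialZeros.indicator zeroWeight ρ =
      (∑ ρ ∈ zerosInBall R, (zeroMult ρ : ℂ) * (1 / ρ)).re := by
    intro R
    rw [re_sum]
    refine Finset.sum_congr rfl fun ρ hρ => ?_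
    rw [indicator_of_mem (mem_zerosInBall.1 hρ).1, re_zeroMult_mul_inv]
  have hlim : Tendsto (fun R => ∑ ρ ∈ zerosInBall R, nontrivialZeros.indicator zeroWeight ρ) atTop
      (𝓝 (completedRiemannZeta₀ 0).re) := by
    simp only [hsum]
    exact (continuous_re.tendsto _).comp tendsto_sum_zerosInBall
  have hmono : Monotone fun R => ∑ ρ ∈ zerosInBall R, nontrivialZeros.indicator zeroWeight ρ := by
    intro R R' h
    refine Finset.sum_le_sum_of_subset_of_nonneg (fun ρ hρ => ?_) fun _ _ _ => hnn _
    rw [mem_zerosInBall] at hρ ⊢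
    exact ⟨hρ.1, ball_subset_ball h hρ.2⟩
  refine hasSum_of_isLUB_of_nonneg _ hnn ⟨?_, ?_⟩
  · rintro _ ⟨u, rfl⟩
    obtain ⟨R, hR⟩ := u.finite_toSet.isBounded.subset_ball (1 / 2 : ℂ)
    refine le_trans ?_ (hmono.ge_of_tendsto hlim R)
    classical
    beta_reduce
    rw [← Finset.sum_filter_of_ne (s := u) (p := (· ∈ nontrivialZeros))
      fun ρ _ hne => mem_of_indicator_ne_zero hne]
    refine Finset.sum_le_sum_of_subset_of_nonneg (fun ρ hρ => ?_) fun _ _ _ => hnn _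
    rw [Finset.mem_filter] at hρ
    exact mem_zerosInBall.2 ⟨hρ.2, hR hρ.1⟩
  · intro B hB
    exact le_of_tendsto' hlim fun R => hB ⟨zerosInBall R, rfl⟩

theorem tendsto_sum_zeroWeight_zerosUpTo :
    Tendsto (fun T => ∑ ρ ∈ zerosUpTo T, zeroWeight ρ) atTop
      (𝓝 (completedRiemannZeta₀ 0).re) := by
  have h : HasSum (fun ρ : nontrivialZeros => zeroWeight ρ) (completedRiemannZeta₀ 0).re :=
    (hasSum_subtype_iff_indicator (f := zeroWeight)).2 hasSum_indicator_zeroWeight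
  classical
  have ht : Tendsto (fun T => (zerosUpTo T).subtype (· ∈ nontrivialZeros)) atTop atTop := by
    refine tendsto_atTop_finset_of_monotone (fun T T' hT ρ hρ => ?_) fun ρ => ⟨|(ρ : ℂ).im|, ?_⟩
    · rw [Finset.mem_subtype, mem_zerosUpTo] at hρ ⊢
      exact ⟨hρ.1, hρ.2.trans hT⟩
    · rw [Finset.mem_subtype, mem_zerosUpTo]
      exact ⟨ρ.2, le_rfl⟩
  refine (h.comp ht).congr fun T => ?_
  exact Finset.sum_subtype_of_mem _ fun ρ hρ => (mem_zerosUpTo.1 hρ).1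

theorem sum_zerosUpTo_eq (T : ℝ) :
    ∑ ρ ∈ zerosUpTo T, (zeroMult ρ : ℂ) * (1 / ρ) =
      ((∑ ρ ∈ zerosUpTo T, zeroWeight ρ : ℝ) : ℂ) := by
  have hconj : (starRingEnd ℂ) (∑ ρ ∈ zerosUpTo T, (zeroMult ρ : ℂ) * (1 / ρ)) =
      ∑ ρ ∈ zerosUpTo T, (zeroMult ρ : ℂ) * (1 / ρ) := by
    have hm : ∀ ρ ∈ zerosUpTo T, (starRingEnd ℂ) ρ ∈ zerosUpTo T := by
      intro ρ hρ
      rw [mem_zerosUpTo] at hρ ⊢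
      exact ⟨conj_mem_nontrivialZeros hρ.1, by simpa using hρ.2⟩
    rw [map_sum]
    refine Finset.sum_nbij' (starRingEnd ℂ) (starRingEnd ℂ) hm hm (by simp) (by simp) ?_
    intro ρ hρ
    rw [zeroMult_conj (mem_zerosUpTo.1 hρ).1]
    simp
  rw [← conj_eq_iff_re.1 hconj, re_sum]
  simp only [re_zeroMult_mul_inv]

theorem hasSum_zeroWeight_upperZeros :
    HasSum (fun s : upperZeros => zeroWeight s) ((completedRiemannZeta₀ 0).re / 2) := by
  set U := upperZeros.indicator zeroWeight with hU
  have hsub : upperZeros ⊆ nontrivialZeros := fun ρ h => h.1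
  have hs : Summable U := by
    have := hasSum_indicator_zeroWeight.summable.indicator upperZeros
    rwa [indicator_indicator, inter_eq_left.2 hsub] at this
  set e : ℂ ≃ ℂ := Function.Involutive.toPerm (starRingEnd ℂ) conj_conj with he
  have hs' : HasSum (U ∘ e) (∑' ρ, U ρ) := e.hasSum_iff.2 hs.hasSum
  -- No nontrivial zero is real, so the zeros split into the upper ones and their conjugates, of
  -- equal weight.
  have heq : nontrivialZeros.indicator zeroWeight = fun ρ => U ρ + (U ∘ e) ρ := by
    funext ρ
    have heρ : e ρ = (starRingEnd ℂ) ρ := rfl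
    simp only [Function.comp_apply, heρ, hU]
    by_cases h : ρ ∈ nontrivialZeros
    · rw [indicator_of_mem h]
      rcases lt_or_gt_of_ne (im_ne_zero_of_mem_nontrivialZeros h) with him | him
      · rw [indicator_of_notMem fun h' : ρ ∈ upperZeros => him.not_gt h'.2, indicator_of_mem,
          zeroWeight_conj h, zero_add]
        exact ⟨conj_mem_nontrivialZeros h, by simpa using him⟩
      · rw [indicator_of_mem (show ρ ∈ upperZeros from ⟨h, him⟩), indicator_of_notMem, add_zero]
        intro h'
        have := h'.2
        rw [conj_im] at this
        linarith
    · rw [indicator_of_notMem h, indicator_of_notMem fun h' => h (hsub h'),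
        indicator_of_notMem, add_zero]
      intro h'
      have := conj_mem_nontrivialZeros h'.1
      rw [conj_conj] at this
      exact h this
  have htot := hs.hasSum.add hs'
  have huniq := (heq ▸ hasSum_indicator_zeroWeight).unique htot
  rw [huniq, add_self_div_two]
  exact (hasSum_subtype_iff_indicator (f := zeroWeight)).2 hs.hasSum

theorem zeroMult_mul_re_div (s : ℂ) :
    (zeroMult s : ℂ) * ((s.re : ℂ) / (s * (starRingEnd ℂ) s)) = (zeroWeight s : ℂ) := by
  rw [mul_conj, zeroWeight]
  push_cast
  rfl

theorem zeroMult_mul_inv_add_inv {s : ℂ} (hs : s ≠ 0) :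
    (zeroMult s : ℂ) * (1 / s + 1 / (starRingEnd ℂ) s) = 2 * (zeroWeight s : ℂ) := by
  rw [← zeroMult_mul_re_div]
  have h : (starRingEnd ℂ) s ≠ 0 := (map_ne_zero _).2 hs
  have h2 : (s.re : ℂ) = (s + (starRingEnd ℂ) s) / 2 := re_eq_add_conj s
  rw [h2]
  field_simp
  ring

/-! ### Taylor coefficients at `1/2` -/

/-- A function symmetric about `1/2` has vanishing odd derivatives there. -/
theorem iteratedDeriv_odd_eq_zero {f : ℂ → ℂ} (hsymm : ∀ s, f (1 - s) = f s) {n : ℕ}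
    (hn : Odd n) : iteratedDeriv n f (1 / 2) = 0 := by
  have h := iteratedDeriv_comp_const_sub n f 1
  have hf : (fun s => f (1 - s)) = f := funext hsymm
  rw [hf] at h
  have := congrFun h (1 / 2)
  simp only [hn.neg_one_pow] at this
  rw [show (1 : ℂ) - 1 / 2 = 1 / 2 by norm_num] at this
  simp only [neg_smul, one_smul] at this
  exact self_eq_neg.1 this

theorem hasSum_evenTaylorCoeff (s : ℂ) :
    HasSum (fun n : ℕ => evenTaylorCoeff n * (s - 1 / 2) ^ (2 * n)) (xi s) := by
  have h := hasSum_taylorSeries_of_entire differentiable_xi (1 / 2) s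
  have hinj : Function.Injective fun n : ℕ => 2 * n := fun a b hab => by
    simpa using hab
  rw [← hinj.hasSum_iff] at h
  · refine h.congr_fun fun n => ?_
    simp only [Function.comp_apply, smul_eq_mul, evenTaylorCoeff]
    ring
  · intro n hn
    have : Odd n := by
      rw [← Nat.not_even_iff_odd]
      rintro ⟨k, rfl⟩
      exact hn ⟨k, by simp; ring⟩
    rw [iteratedDeriv_odd_eq_zero xi_one_sub this]
    simp

theorem hasDerivAt_xi_one : HasDerivAt xi (1 / 2 * completedRiemannZeta₀ 0) 1 := by
  have h0 : HasDerivAt xi (-(1 / 2) * completedRiemannZeta₀ 0) (1 - 1) := by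
    simpa using hasDerivAt_xi_zero
  have h := h0.comp_const_sub 1 1
  rw [show (fun s => xi (1 - s)) = xi from funext xi_one_sub] at h
  exact h.congr_deriv (by ring)

theorem hasSum_succ_mul_evenTaylorCoeff :
    HasSum (fun n : ℕ => ((n + 1 : ℕ) : ℂ) * evenTaylorCoeff (n + 1) / 2 ^ (2 * (n + 1)))
      (completedRiemannZeta₀ 0 / 8) := by
  have h := hasSum_taylorSeries_of_entire differentiable_xi.deriv (1 / 2) 1
  rw [hasDerivAt_xi_one.deriv] at h
  have hinj : Function.Injective fun n : ℕ => 2 * n + 1 := fun a b hab => by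
    simpa using hab
  rw [← hinj.hasSum_iff] at h
  -- The series of `ξ'` at `1` has terms `(2n+2) a_{2n+2} / 2^(2n+1)`, four times the required ones.
  · have h' := h.div_const 4
    rw [show (1 / 2 * completedRiemannZeta₀ 0) / 4 = completedRiemannZeta₀ 0 / 8 by ring] at h'
    refine h'.congr_fun fun n => ?_
    simp only [Function.comp_apply, smul_eq_mul, evenTaylorCoeff, ← iteratedDeriv_succ']
    rw [show 2 * (n + 1) = 2 * n + 1 + 1 by ring, Nat.factorial_succ,
      show (1 : ℂ) - 1 / 2 = 1 / 2 by norm_num]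
    have hf : ((2 * n + 1).factorial : ℂ) ≠ 0 := Nat.cast_ne_zero.2 (Nat.factorial_ne_zero _)
    have hn : (n : ℂ) + 1 ≠ 0 := Nat.cast_add_one_ne_zero n
    push_cast
    rw [div_pow, one_pow, pow_succ (2 : ℂ) (2 * n + 1),
      show 2 * (n : ℂ) + 1 + 1 = 2 * (n + 1) by ring]
    field_simp
    norm_num [mul_comm]
  · intro n hn
    have : Even n := by
      rw [← Nat.not_odd_iff_even]
      rintro ⟨k, rfl⟩
      exact hn ⟨k, rfl⟩
    rw [← iteratedDeriv_succ', iteratedDeriv_odd_eq_zero xi_one_sub this.add_one]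
    simp

end ZetaZeroSum

/-! ### The main theorem -/

open ZetaZeroSum in
theorem mainTheorem7 (S : ℝ)
    (hS : S = 1 + Real.eulerMascheroniConstant / 2 - Real.log (4 * Real.pi) / 2) :
    -- the Taylor series of `ξ` around `1/2`
    (∀ s : ℂ, HasSum (fun n : ℕ => evenTaylorCoeff n * (s - 1 / 2) ^ (2 * n)) (xi s)) ∧
    -- the sum of `1/ρ` over all nontrivial zeros, by increasing `|Im ρ|`
    Filter.Tendsto (fun T : ℝ => ∑ ρ ∈ zerosUpTo T, (zeroMult ρ : ℂ) * (1 / ρ))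
      Filter.atTop (nhds (S : ℂ)) ∧
    -- the same sum, by conjugate pairs
    HasSum (fun s : upperZeros =>
      (zeroMult s : ℂ) * (1 / (s : ℂ) + 1 / (starRingEnd ℂ) (s : ℂ))) (S : ℂ) ∧
    -- twice the sum of `σ_r / (s_r * conj s_r)`
    Summable (fun s : upperZeros =>
      (zeroMult s : ℂ) * (((s : ℂ).re : ℂ) / ((s : ℂ) * (starRingEnd ℂ) (s : ℂ)))) ∧
    2 * ∑' s : upperZeros,
      (zeroMult s : ℂ) * (((s : ℂ).re : ℂ) / ((s : ℂ) * (starRingEnd ℂ) (s : ℂ))) = (S : ℂ) ∧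
    -- the sum over the Taylor coefficients
    Summable (fun n : ℕ => ((n + 1 : ℕ) : ℂ) * evenTaylorCoeff (n + 1) / 2 ^ (2 * (n + 1))) ∧
    8 * ∑' n : ℕ, ((n + 1 : ℕ) : ℂ) * evenTaylorCoeff (n + 1) / 2 ^ (2 * (n + 1)) = (S : ℂ) ∧
    -- the coefficient of `s` in the expansion of `ξ` in powers of `s`
    HasDerivAt xi (-(1 / 2) * (S : ℂ)) 0 := by
  have hS0 : completedRiemannZeta₀ 0 = (S : ℂ) := by rw [completedRiemannZeta₀_zero_eq, hS]
  have hre : (completedRiemannZeta₀ 0).re = S := by rw [hS0, Complex.ofReal_re]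
  have hU := Complex.hasSum_ofReal.2 (hre ▸ hasSum_zeroWeight_upperZeros)
  have hU' : HasSum (fun s : upperZeros => (zeroMult s : ℂ) *
      (((s : ℂ).re : ℂ) / ((s : ℂ) * (starRingEnd ℂ) (s : ℂ)))) ((S / 2 : ℝ) : ℂ) :=
    hU.congr_fun fun s => zeroMult_mul_re_div s
  have hT := hS0 ▸ hasSum_succ_mul_evenTaylorCoeff
  refine ⟨hasSum_evenTaylorCoeff, ?_, ?_, hU'.summable, ?_, hT.summable, ?_, ?_⟩
  · simp only [sum_zerosUpTo_eq]
    exact (Complex.continuous_ofReal.tendsto _).comp (hre ▸ tendsto_sum_zeroWeight_zerosUpTo)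
  · have h2 := hU.mul_left 2
    rw [show (2 : ℂ) * ((S / 2 : ℝ) : ℂ) = S by push_cast; ring] at h2
    exact h2.congr_fun fun s => zeroMult_mul_inv_add_inv (ne_zero_of_mem_nontrivialZeros s.2.1)
  · rw [hU'.tsum_eq]
    push_cast
    ring
  · rw [hT.tsum_eq]
    ring
  · exact hS0 ▸ hasDerivAt_xi_zero
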